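/- For a finite simple graph $G$ with edge set $E(G)$, let $Q_G(x)=\sum_T\prod_{e\in T}x_e\in\mathbb{Z}[x_e : e\in E(G)]$, where $T$ ranges over (the edge sets of) all spanning trees of $G$. For a prime power $q$, let $g_G(q)$ be the number of points $x\in\mathbb{F}_q^{E(G)}$ with $Q_G(x)\neq 0$. Let $K_n$ be the complete graph on $n\ge 1$ vertices. **Theorem.** Let $n\ge 1$ and let $q$ be a prime power. Then $g_{K_n}(q)$ equals the number of invertible symmetric $(n-1)\times(n-1)$ matrices over $\mathbb{F}_q$, and $$g_{K_n}(q)=\begin{cases} q^{m(m-1)}(q-1)(q^3-1)\cdots(q^{2m-1}-1), & n=2m,\\[4pt] q^{m(m+1)}(q-1)(q^3-1)\cdots(q^{2m-1}-1), & n=2m+1,\end{cases}$$ where for $n=1$ (that is, $m=0$) the product is empty and equals $1$; there is exactly one $0\times 0$ matrix, and it is invertible. -/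

import Mathlib

namespace SpanningTreeCount

/-- A set `T` of edges of `G` is (the edge set of) a spanning tree of `G` when the graph on all
vertices of `G` with edge set `T` is a tree. -/
def IsSpanningTree {V : Type*} (G : SimpleGraph V) (T : Finset G.edgeSet) : Prop :=
  (SimpleGraph.fromEdgeSet {e : Sym2 V | ∃ he : e ∈ G.edgeSet, (⟨e, he⟩ : G.edgeSet) ∈ T}).IsTree

open Classical in
/-- The spanning-tree polynomial `Q_G(x) = ∑_T ∏_{e ∈ T} x_e`, with one variable per edge of `G`
and integer coefficients, the sum being over all spanning trees `T` of `G`. -/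
noncomputable def treePoly {V : Type*} (G : SimpleGraph V) [Fintype G.edgeSet] :
    MvPolynomial G.edgeSet ℤ :=
  ∑ T : Finset G.edgeSet with IsSpanningTree G T, ∏ e ∈ T, MvPolynomial.X e

/-- The number `g_G(q)` of ways of substituting elements of the field `F` (with `q` elements) for
the variables `x_e` so that `Q_G(x) ≠ 0`. -/
noncomputable def g {V : Type*} (G : SimpleGraph V) [Fintype G.edgeSet] (F : Type*) [Field F] : ℕ :=
  Nat.card {x : G.edgeSet → F // MvPolynomial.aeval x (treePoly G) ≠ 0}

end SpanningTreeCount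

/-! By the weighted matrix-tree theorem (`aeval_treePoly`), `Q_G(x)` is the determinant of the
weighted Laplacian with one row and column deleted. For a complete graph this reduced Laplacian runs
bijectively over all symmetric matrices (`bijective_reducedLap`): off-diagonal entries are minus the
weights of edges avoiding the deleted vertex, and row sums are the weights of the edges at it. It
remains to count invertible symmetric matrices by corner `a` and border `v`. If `a ≠ 0`, a Schur
complement drops the size by one; if `a = 0` and `v ≠ 0`, a congruence makes `v` a unit vector and
the size drops by two. The recursion `symmCount_add_two` yields the product formula. -/

namespace SpanningTreeCount

open Matrix

/-! ### Bordered determinants -/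

/-- The symmetric matrix obtained from `A` by adding a corner `a` and a border `v`. -/
def bordered {R : Type*} {k : ℕ} (a : R) (v : Fin k → R) (A : Matrix (Fin k) (Fin k) R) :
    Matrix (Fin (k + 1)) (Fin (k + 1)) R :=
  Matrix.of (Fin.cons (Fin.cons a v : Fin (k + 1) → R)
    fun i => (Fin.cons (v i) (A i) : Fin (k + 1) → R))

section bordered

variable {R : Type*} {k : ℕ} (a : R) (v : Fin k → R) (A : Matrix (Fin k) (Fin k) R)

@[simp] theorem bordered_zero_zero : bordered a v A 0 0 = a := rfl

@[simp] theorem bordered_zero_succ (j : Fin k) : bordered a v A 0 j.succ = v j := rfl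

@[simp] theorem bordered_succ_zero (i : Fin k) : bordered a v A i.succ 0 = v i := rfl

@[simp] theorem bordered_succ_succ (i j : Fin k) : bordered a v A i.succ j.succ = A i j := rfl

theorem isSymm_bordered_iff : (bordered a v A).IsSymm ↔ A.IsSymm := by
  simp [IsSymm.ext_iff, Fin.forall_fin_succ]

theorem bordered_eq_self (M : Matrix (Fin (k + 1)) (Fin (k + 1)) R) (hM : M.IsSymm) :
    bordered (M 0 0) (fun i => M 0 i.succ) (M.submatrix Fin.succ Fin.succ) = M := by
  ext i j
  cases i using Fin.cases <;> cases j using Fin.cases <;> simp [hM.apply]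

end bordered

/-- Schur complement: subtracting `a⁻¹ * v i` times the top row clears the first column. -/
theorem det_bordered_eq_mul {F : Type*} [Field F] {k : ℕ} {a : F} (ha : a ≠ 0) (v : Fin k → F)
    (A : Matrix (Fin k) (Fin k) F) :
    (bordered a v A).det = a * (A - Matrix.of fun i j => a⁻¹ * v i * v j).det := by
  let B : Matrix (Fin (k + 1)) (Fin (k + 1)) F :=
    Matrix.of (Fin.cons (Fin.cons a v : Fin (k + 1) → F)
      fun i => (Fin.cons 0 ((A - Matrix.of fun i j => a⁻¹ * v i * v j) i) : Fin (k + 1) → F))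
  have h : (bordered a v A).det = B.det := by
    refine det_eq_of_forall_row_eq_smul_add_const (Fin.cons 0 fun i => a⁻¹ * v i) 0 rfl
      fun i j => ?_
    cases i using Fin.cases <;> cases j using Fin.cases <;> simp [B]
    field_simp
  rw [h, det_succ_column_zero, Fin.sum_univ_succ]
  simp only [B]
  simp
  left
  congr 1

theorem det_bordered_zero_single {R : Type*} [CommRing R] {k : ℕ}
    (A : Matrix (Fin (k + 1)) (Fin (k + 1)) R) :
    (bordered 0 (Pi.single 0 1) A).det = - (A.submatrix Fin.succ Fin.succ).det := by
  rw [det_succ_row_zero, Fin.sum_univ_succ, Fin.sum_univ_succ]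
  simp only [bordered_zero_zero, bordered_zero_succ]
  simp [det_succ_column_zero, Fin.sum_univ_succ]
  congr 1

theorem det_bordered_zero_zero {R : Type*} [CommRing R] {k : ℕ} (A : Matrix (Fin k) (Fin k) R) :
    (bordered 0 0 A).det = 0 :=
  det_eq_zero_of_row_eq_zero 0 fun j => by cases j using Fin.cases <;> simp

/-- Congruence by the block sum of `1` and `P`. -/
theorem det_bordered_congruence {R : Type*} [CommRing R] {k : ℕ} (a : R) (v : Fin k → R)
    (A P : Matrix (Fin k) (Fin k) R) :
    (bordered a (P *ᵥ v) (P * A * Pᵀ)).det = P.det ^ 2 * (bordered a v A).det := by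
  have hdet : (bordered 1 0 P).det = P.det := by
    rw [det_succ_row_zero, Fin.sum_univ_succ]
    simp
    congr 1
  have h : bordered a (P *ᵥ v) (P * A * Pᵀ) =
      bordered 1 0 P * bordered a v A * (bordered 1 0 P)ᵀ := by
    ext i j
    cases i using Fin.cases <;> cases j using Fin.cases <;>
      simp [mul_apply, Fin.sum_univ_succ, mulVec, dotProduct, mul_comm]
  rw [h, det_mul, det_mul, det_transpose, hdet]
  ring

theorem exists_det_ne_zero_mulVec_single {F : Type*} [Field F] {k : ℕ} {v : Fin (k + 1) → F}
    (hv : v ≠ 0) : ∃ P : Matrix (Fin (k + 1)) (Fin (k + 1)) F,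
      P.det ≠ 0 ∧ P *ᵥ Pi.single 0 1 = v := by
  obtain ⟨j, hj⟩ := Function.ne_iff.1 hv
  -- The identity with column `j` replaced by `v` has determinant `v j ≠ 0`; the swap then moves
  -- that column to position `0`.
  refine ⟨((1 : Matrix _ _ F).updateCol j v).submatrix id (Equiv.swap 0 j), ?_, ?_⟩
  · rw [det_permute', ← cramer_apply, cramer_one]
    refine mul_ne_zero ?_ hj
    rcases Int.units_eq_one_or (Equiv.Perm.sign (Equiv.swap 0 j)) with h | h <;> simp [h]
  · ext i
    simp

/-! ### Counting invertible symmetric matrices -/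

section count

variable (F : Type*) [Field F]

/-- The number of invertible symmetric `k × k` matrices over `F`. -/
noncomputable def symmCount (k : ℕ) : ℕ :=
  Nat.card {M : Matrix (Fin k) (Fin k) F // M.IsSymm ∧ IsUnit M}

variable {F} in
/-- The number of symmetric `A` for which the bordered matrix is invertible. -/
noncomputable def borderCount {k : ℕ} (a : F) (v : Fin k → F) : ℕ :=
  Nat.card {A : Matrix (Fin k) (Fin k) F // A.IsSymm ∧ (bordered a v A).det ≠ 0}

theorem symmCount_eq (k : ℕ) :
    symmCount F k = Nat.card {M : Matrix (Fin k) (Fin k) F // M.IsSymm ∧ M.det ≠ 0} := by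
  simp [symmCount, isUnit_iff_isUnit_det]

theorem symmCount_zero : symmCount F 0 = 1 := by
  rw [symmCount_eq, Nat.card_eq_one_iff_unique]
  exact ⟨inferInstance, ⟨⟨0, by simp [IsSymm], by simp⟩⟩⟩

/-- Symmetric matrices of size `k + 1` are determined by their corner, border and remainder. -/
def borderedEquiv (k : ℕ) (p : Matrix (Fin (k + 1)) (Fin (k + 1)) F → Prop) :
    {M : Matrix (Fin (k + 1)) (Fin (k + 1)) F // M.IsSymm ∧ p M} ≃
      Σ b : F × (Fin k → F), {A : Matrix (Fin k) (Fin k) F // A.IsSymm ∧ p (bordered b.1 b.2 A)}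
    where
  toFun M := ⟨(M.1 0 0, fun i => M.1 0 i.succ), M.1.submatrix Fin.succ Fin.succ,
    M.2.1.submatrix _, by simpa only [bordered_eq_self M.1 M.2.1] using M.2.2⟩
  invFun x := ⟨bordered x.1.1 x.1.2 x.2.1, (isSymm_bordered_iff _ _ _).2 x.2.2.1, x.2.2.2⟩
  left_inv M := Subtype.ext (bordered_eq_self M.1 M.2.1)
  right_inv _ := rfl

theorem symmCount_succ [Fintype F] (k : ℕ) :
    symmCount F (k + 1) = ∑ a : F, ∑ v : Fin k → F, borderCount a v := by
  rw [symmCount_eq, Nat.card_congr (borderedEquiv F k fun M => M.det ≠ 0), Nat.card_sigma,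
    Fintype.sum_prod_type]
  rfl

variable {F}

/-- Passing to the Schur complement translates `A` by a fixed symmetric matrix. -/
theorem borderCount_of_ne_zero {k : ℕ} {a : F} (ha : a ≠ 0) (v : Fin k → F) :
    borderCount a v = symmCount F k := by
  rw [symmCount_eq]
  have hs : (Matrix.of fun i j => a⁻¹ * v i * v j).IsSymm := by
    ext i j
    simp only [transpose_apply, of_apply]
    ring
  refine Nat.card_congr ((Equiv.subRight (Matrix.of fun i j => a⁻¹ * v i * v j)).subtypeEquiv
    fun A => ?_)
  simp only [det_bordered_eq_mul ha, Equiv.subRight_apply, mul_ne_zero_iff, ne_eq, ha,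
    not_false_eq_true, true_and]
  refine and_congr_left fun _ => ⟨fun h => h.sub hs, fun h => ?_⟩
  simpa using h.add hs

theorem borderCount_zero_zero (k : ℕ) : borderCount (0 : F) (0 : Fin k → F) = 0 := by
  simp [borderCount, det_bordered_zero_zero]

/-- The determinant sees only the lower right block of `A`; the `k + 1` entries of its first row are
free. -/
theorem borderCount_zero_single [Fintype F] (k : ℕ) :
    borderCount (0 : F) (Pi.single 0 1 : Fin (k + 1) → F) =
      Fintype.card F ^ (k + 1) * symmCount F k := by
  simp only [borderCount, det_bordered_zero_single, neg_ne_zero]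
  rw [Nat.card_congr (borderedEquiv F k fun M => (M.submatrix Fin.succ Fin.succ).det ≠ 0),
    Nat.card_sigma, symmCount_eq]
  have h (a : F) (v : Fin k → F) (A : Matrix (Fin k) (Fin k) F) :
      (bordered a v A).submatrix Fin.succ Fin.succ = A := rfl
  simp [h, pow_succ']

theorem borderCount_zero_of_ne_zero {k : ℕ} {v : Fin (k + 1) → F} (hv : v ≠ 0) :
    borderCount 0 v = borderCount (0 : F) (Pi.single 0 1 : Fin (k + 1) → F) := by
  obtain ⟨P, hP, rfl⟩ := exists_det_ne_zero_mulVec_single hv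
  have hu : IsUnit P.det := hP.isUnit
  have hu' : IsUnit Pᵀ.det := by simpa using hu
  refine (Nat.card_congr (Equiv.subtypeEquiv
    ⟨fun A => P * A * Pᵀ, fun A => P⁻¹ * A * Pᵀ⁻¹, fun A => ?_, fun A => ?_⟩ fun A => ?_)).symm
  · simp only [mul_assoc, mul_nonsing_inv _ hu', mul_one, nonsing_inv_mul_cancel_left _ _ hu]
  · simp only [mul_assoc, nonsing_inv_mul _ hu', mul_one, mul_nonsing_inv_cancel_left _ _ hu]
  · simp only [Equiv.coe_fn_mk, det_bordered_congruence, mul_ne_zero_iff]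
    simp only [ne_eq, pow_eq_zero_iff two_ne_zero, hP, not_false_eq_true, true_and]
    refine and_congr_left fun _ => ?_
    simp only [IsSymm, transpose_mul, transpose_transpose, ← mul_assoc]
    refine ⟨fun h => by rw [h], fun h => ?_⟩
    have h' := congrArg (fun X => P⁻¹ * X * Pᵀ⁻¹) h
    simpa only [mul_assoc, mul_nonsing_inv _ hu', mul_one, nonsing_inv_mul_cancel_left _ _ hu]
      using h'

theorem sum_borderCount_ne_zero [Fintype F] {k : ℕ} {a : F} (ha : a ≠ 0) :
    ∑ v : Fin k → F, borderCount a v = Fintype.card F ^ k * symmCount F k := by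
  simp [borderCount_of_ne_zero ha]

theorem symmCount_one [Fintype F] : symmCount F 1 = Fintype.card F - 1 := by
  classical
  rw [symmCount_succ, Fintype.sum_eq_add_sum_compl 0,
    Finset.sum_congr rfl fun a ha => sum_borderCount_ne_zero (by simpa using ha)]
  have h (v : Fin 0 → F) : borderCount 0 v = 0 := by
    rw [Subsingleton.elim v 0, borderCount_zero_zero]
  simp [h, Finset.card_compl, symmCount_zero]

theorem symmCount_add_two [Fintype F] (k : ℕ) :
    symmCount F (k + 2) =
      (Fintype.card F - 1) * (Fintype.card F ^ (k + 1) * symmCount F (k + 1)) +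
        (Fintype.card F ^ (k + 1) - 1) * (Fintype.card F ^ (k + 1) * symmCount F k) := by
  classical
  rw [symmCount_succ, Fintype.sum_eq_add_sum_compl 0,
    Finset.sum_congr rfl fun a ha => sum_borderCount_ne_zero (by simpa using ha),
    Fintype.sum_eq_add_sum_compl 0, borderCount_zero_zero,
    Finset.sum_congr rfl fun v hv =>
      (borderCount_zero_of_ne_zero (by simpa using hv)).trans (borderCount_zero_single k)]
  simp [Finset.card_compl, add_comm]

theorem symmCount_two_mul_and [Fintype F] (m : ℕ) :
    (symmCount F (2 * m) : ℤ) = (Fintype.card F : ℤ) ^ (m * (m + 1)) *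
        ∏ i ∈ Finset.Icc 1 m, ((Fintype.card F : ℤ) ^ (2 * i - 1) - 1) ∧
      (symmCount F (2 * m + 1) : ℤ) = (Fintype.card F : ℤ) ^ (m * (m + 1)) *
        ∏ i ∈ Finset.Icc 1 (m + 1), ((Fintype.card F : ℤ) ^ (2 * i - 1) - 1) := by
  -- Over `ℤ` the subtractions are no longer truncated, so `ring` applies.
  have hrec (k : ℕ) : (symmCount F (k + 2) : ℤ) =
      (Fintype.card F - 1) * (Fintype.card F ^ (k + 1) * symmCount F (k + 1)) +
        (Fintype.card F ^ (k + 1) - 1) * (Fintype.card F ^ (k + 1) * symmCount F k) := by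
    have h1 : 1 ≤ Fintype.card F := Fintype.card_pos
    rw [symmCount_add_two]
    push_cast [Nat.cast_sub h1, Nat.cast_sub (Nat.one_le_pow (k + 1) _ h1)]
    ring
  induction m with
  | zero =>
    have h1 : 1 ≤ Fintype.card F := Fintype.card_pos
    simp [symmCount_zero, symmCount_one, Nat.cast_sub h1]
  | succ m ih =>
    obtain ⟨h0, h1⟩ := ih
    rw [Finset.prod_Icc_succ_top (by omega)] at h1
    have h2 := hrec (2 * m)
    rw [h0, h1] at h2
    have h3 := hrec (2 * m + 1)
    rw [h1, h2] at h3
    rw [show 2 * (m + 1) - 1 = 2 * m + 1 by omega] at h1 h2 h3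
    rw [show 2 * (m + 1) + 1 = 2 * m + 1 + 2 by omega, show 2 * (m + 1) = 2 * m + 2 by omega,
      h3, h2, Finset.prod_Icc_succ_top (by omega), Finset.prod_Icc_succ_top (by omega),
      Finset.prod_Icc_succ_top (by omega),
      show 2 * (m + 1) - 1 = 2 * m + 1 by omega, show 2 * (m + 1 + 1) - 1 = 2 * m + 3 by omega]
    constructor <;> ring

end count

/-! ### A weighted Cauchy–Binet expansion -/

section CauchyBinet

variable {m E R : Type*} [Fintype m] [DecidableEq m] [Fintype E] [CommRing R]

/-- The product `A * diagonal x * B`, written out. -/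
def weightedMul (A : Matrix m E R) (x : E → R) (B : Matrix E m R) : Matrix m m R :=
  Matrix.of fun i j => ∑ e, x e * A i e * B e j

theorem det_weightedMul (A : Matrix m E R) (x : E → R) (B : Matrix E m R) :
    (weightedMul A x B).det =
      ∑ r : m → E, (∏ i, x (r i)) * ((∏ i, A i (r i)) * (B.submatrix r id).det) := by
  have h : weightedMul A x B = fun i => ∑ e, (x e * A i e) • B e := by
    ext i j
    simp [weightedMul]
  rw [h]
  change detRowAlternating.toMultilinearMap _ = _
  rw [MultilinearMap.map_sum]
  refine Finset.sum_congr rfl fun r _ => ?_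
  rw [MultilinearMap.map_smul_univ, Finset.prod_mul_distrib, smul_eq_mul, mul_assoc]
  rfl

-- Group the maps `r` by image: non-injective ones repeat a row of `B` and vanish. Indicator weights
-- express the coefficient of `S` without enumerating `S`.
open Classical in
theorem det_weightedMul_eq_sum_powersetCard (A : Matrix m E R) (x : E → R) (B : Matrix E m R) :
    (weightedMul A x B).det =
      ∑ S ∈ Finset.powersetCard (Fintype.card m) Finset.univ,
        (∏ e ∈ S, x e) * (weightedMul A ((S : Set _).indicator 1) B).det := by
  simp only [det_weightedMul, Finset.mul_sum]
  rw [Finset.sum_comm]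
  refine Finset.sum_congr rfl fun r _ => ?_
  by_cases hr : Function.Injective r
  · have hcard : (Finset.univ.image r).card = Fintype.card m :=
      Finset.card_image_of_injective _ hr
    rw [Finset.sum_eq_single (Finset.univ.image r)]
    · have h1 : ∏ i, (Finset.univ.image r : Set E).indicator (1 : E → R) (r i) = 1 :=
        Finset.prod_eq_one fun i _ => Set.indicator_of_mem
          (Finset.mem_coe.2 (Finset.mem_image_of_mem r (Finset.mem_univ i))) _
      rw [Finset.prod_image hr.injOn, h1, one_mul]
    · intro S hS hne
      obtain ⟨i, hi⟩ : ∃ i, r i ∉ S := by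
        by_contra! h
        refine hne (Finset.eq_of_subset_of_card_le (fun e he => ?_) ?_).symm
        · obtain ⟨i, -, rfl⟩ := Finset.mem_image.1 he
          exact h i
        · rw [hcard, (Finset.mem_powersetCard.1 hS).2]
      have h0 : ∏ i, (S : Set E).indicator (1 : E → R) (r i) = 0 :=
        Finset.prod_eq_zero (Finset.mem_univ i)
          (Set.indicator_of_notMem (fun h => hi (Finset.mem_coe.1 h)) _)
      rw [h0, zero_mul, mul_zero]
    · simp [Finset.mem_powersetCard, hcard]
  · obtain ⟨i, j, hij, hne⟩ := Function.not_injective_iff.1 hr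
    have h0 : (B.submatrix r id).det = 0 :=
      det_zero_of_row_eq hne (by ext; simp [hij])
    simp [h0]

theorem det_weightedMul_indicator (A : Matrix m E R) (B : Matrix E m R) (f : m ↪ E) :
    (weightedMul A ((Finset.univ.map f : Set E).indicator 1) B).det =
      (A.submatrix id f).det * (B.submatrix f id).det := by
  rw [← det_mul]
  congr 1
  ext i j
  simp only [weightedMul, of_apply, mul_apply, submatrix_apply, id_eq]
  rw [← Finset.sum_map Finset.univ f fun e => A i e * B e j]
  refine (Finset.sum_congr rfl fun e he => ?_).trans
    (Finset.sum_subset (Finset.subset_univ (Finset.univ.map f)) fun e _ he => ?_) |>.symm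
  · rw [Set.indicator_of_mem (Finset.mem_coe.2 he), Pi.one_apply, one_mul]
  · rw [Set.indicator_of_notMem (mt Finset.mem_coe.1 he), zero_mul, zero_mul]

end CauchyBinet

/-! ### Oriented incidence matrix and weighted Laplacian -/

section Incidence

theorem exists_out_eq {V : Type*} {G : SimpleGraph V} (e : G.edgeSet) :
    ∃ a b, G.Adj a b ∧ e.1 = s(a, b) ∧ Quot.out e.1 = (a, b) := by
  obtain ⟨e, he⟩ := e
  have h : e = s((Quot.out e).1, (Quot.out e).2) := (Quot.out_eq e).symm
  exact ⟨_, _, by rwa [h] at he, h, rfl⟩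

variable {V : Type*} [DecidableEq V] (G : SimpleGraph V) (R : Type*) [CommRing R]

/-- The incidence matrix of an (arbitrarily chosen) orientation of `G`. -/
noncomputable def orientedInc : Matrix V G.edgeSet R :=
  Matrix.of fun v e =>
    (if v = (Quot.out e.1).1 then 1 else 0) - (if v = (Quot.out e.1).2 then 1 else 0)

theorem orientedInc_map (S : Type*) [CommRing S] (φ : R →+* S) :
    (orientedInc G R).map φ = orientedInc G S := by
  ext v e
  simp only [orientedInc, map_apply, of_apply, map_sub]
  split_ifs <;> simp

variable {G R} in
theorem sum_mul_orientedInc [Fintype V] (y : V → R) {e : G.edgeSet} {a b : V}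
    (h : Quot.out e.1 = (a, b)) : ∑ v, y v * orientedInc G R v e = y a - y b := by
  simp [orientedInc, h, mul_sub]

variable {G} in
/-- The Laplacian matrix of `G` with edge weights `x`. -/
noncomputable def weightedLap {R : Type*} [CommRing R] [Fintype G.edgeSet] (x : G.edgeSet → R) :
    Matrix V V R :=
  Matrix.of fun v w => ∑ e, x e * orientedInc G R v e * orientedInc G R w e

variable {G R} [Fintype G.edgeSet]

theorem weightedLap_isSymm (x : G.edgeSet → R) : (weightedLap x).IsSymm := by
  ext v w
  simp [weightedLap, mul_right_comm]

theorem weightedLap_apply_of_adj (x : G.edgeSet → R) {v w : V} (h : G.Adj v w) :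
    weightedLap x v w = - x ⟨s(v, w), h⟩ := by
  have hne := h.ne
  simp only [weightedLap, of_apply]
  rw [Finset.sum_eq_single ⟨s(v, w), h⟩]
  · obtain ⟨a, b, hab, he, ho⟩ := exists_out_eq (⟨s(v, w), h⟩ : G.edgeSet)
    simp only at ho he
    simp only [orientedInc, of_apply, ho]
    rcases Sym2.eq_iff.1 he with ⟨rfl, rfl⟩ | ⟨rfl, rfl⟩ <;> simp [hne, hne.symm]
  · intro e _ hne'
    obtain ⟨a, b, hab, he, ho⟩ := exists_out_eq e
    have : s(a, b) ≠ s(v, w) := fun h' => hne' (Subtype.ext (he.trans h'))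
    simp only [orientedInc, of_apply, ho]
    split_ifs <;> simp_all
  · simp

theorem sum_weightedLap [Fintype V] (x : G.edgeSet → R) (v : V) : ∑ w, weightedLap x v w = 0 := by
  simp only [weightedLap, of_apply]
  rw [Finset.sum_comm]
  refine Finset.sum_eq_zero fun e _ => ?_
  obtain ⟨a, b, -, -, ho⟩ := exists_out_eq e
  rw [← Finset.mul_sum]
  have h := sum_mul_orientedInc (fun _ => (1 : R)) ho
  simp only [one_mul, sub_self] at h
  rw [h, mul_zero]

end Incidence

/-! ### The weighted matrix-tree theorem -/

section MatrixTree

variable {k : ℕ} {G : SimpleGraph (Fin (k + 1))}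

/-- The spanning subgraph of `G` with edge set `S`. -/
abbrev edgeSubgraph {V : Type*} {G : SimpleGraph V} (S : Finset G.edgeSet) : SimpleGraph V :=
  SimpleGraph.fromEdgeSet {e : Sym2 V | ∃ he : e ∈ G.edgeSet, (⟨e, he⟩ : G.edgeSet) ∈ S}

theorem edgeSubgraph_adj_of_mem {V : Type*} {G : SimpleGraph V} {S : Finset G.edgeSet}
    {e : G.edgeSet} (he : e ∈ S) {a b : V} (h : e.1 = s(a, b)) : (edgeSubgraph S).Adj a b := by
  obtain ⟨e, he'⟩ := e
  subst h
  exact ⟨⟨he', he⟩, SimpleGraph.Adj.ne he'⟩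

theorem card_edgeSet_edgeSubgraph {V : Type*} {G : SimpleGraph V} (S : Finset G.edgeSet) :
    Nat.card (edgeSubgraph S).edgeSet = S.card := by
  have h : (edgeSubgraph S).edgeSet = Subtype.val '' (S : Set G.edgeSet) := by
    ext e
    simp only [SimpleGraph.edgeSet_fromEdgeSet, Set.mem_sdiff, Set.mem_ofPred_eq, Set.mem_image,
      Finset.mem_coe, Subtype.exists, exists_and_right, exists_eq_right]
    exact ⟨fun h => h.1, fun h => ⟨h, G.not_isDiag_of_mem_edgeSet h.1⟩⟩
  rw [h, Nat.card_coe_set_eq, Set.ncard_image_of_injective _ Subtype.val_injective,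
    Set.ncard_coe_finset]

theorem isSpanningTree_iff (S : Finset G.edgeSet) :
    IsSpanningTree G S ↔ (edgeSubgraph S).Connected ∧ S.card = k := by
  rw [IsSpanningTree, SimpleGraph.isTree_iff_connected_and_card, card_edgeSet_edgeSubgraph]
  simp

/-- The oriented incidence matrix without the row of the vertex `0`, restricted to some columns. -/
noncomputable def reducedInc (R : Type*) [CommRing R] (f : Fin k → G.edgeSet) :
    Matrix (Fin k) (Fin k) R :=
  (orientedInc G R).submatrix Fin.succ f

/-- The column span `W` contains `δ a - δ b` for each chosen edge, and `δ 0 = 0` because the row of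
`0` is deleted. Walking from `0` puts every basis vector in `W`. -/
theorem isUnit_det_reducedInc (R : Type*) [CommRing R] {f : Fin k ↪ G.edgeSet}
    (h : (edgeSubgraph (Finset.univ.map f)).Connected) : IsUnit (reducedInc R f).det := by
  rw [← isUnit_iff_isUnit_det, ← mulVec_surjective_iff_isUnit]
  set W := LinearMap.range (reducedInc R f).mulVecLin with hW
  let δ (v : Fin (k + 1)) (i : Fin k) : R := if i.succ = v then 1 else 0
  have hcol {e : G.edgeSet} (he : e ∈ Finset.univ.map f) {a b : Fin (k + 1)}
      (ho : Quot.out e.1 = (a, b)) : δ a - δ b ∈ W := by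
    obtain ⟨j, -, rfl⟩ := Finset.mem_map.1 he
    refine ⟨Pi.single j 1, ?_⟩
    ext i
    simp [reducedInc, orientedInc, ho, δ]
  have hadj {a b : Fin (k + 1)} (hab : (edgeSubgraph (Finset.univ.map f)).Adj a b)
      (ha : δ a ∈ W) : δ b ∈ W := by
    obtain ⟨⟨hG, he⟩, -⟩ := hab
    obtain ⟨c, d, -, hcd, ho⟩ := exists_out_eq (⟨s(a, b), hG⟩ : G.edgeSet)
    have hc := hcol he ho
    rcases Sym2.eq_iff.1 hcd with ⟨rfl, rfl⟩ | ⟨rfl, rfl⟩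
    · simpa using W.sub_mem ha hc
    · simpa using W.add_mem hc ha
  have hmem (v : Fin (k + 1)) : δ v ∈ W := by
    have h0 : δ 0 ∈ W := by
      have : δ 0 = 0 := by ext i; simp [δ, Fin.succ_ne_zero]
      rw [this]
      exact W.zero_mem
    have hr := (SimpleGraph.reachable_iff_reflTransGen _ _).1 (h.preconnected 0 v)
    induction hr with
    | refl => exact h0
    | tail _ hbc ih => exact hadj hbc ih
  intro y
  have hy : y = ∑ i, y i • δ i.succ := by
    ext j
    simp [δ]
  have : y ∈ W := by
    rw [hy]
    exact W.sum_mem fun i _ => W.smul_mem _ (hmem _)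
  exact this

-- The indicator of the vertices not reachable from `0` is a nonzero left kernel vector.
open Classical in
theorem det_reducedInc_eq_zero (R : Type*) [CommRing R] [IsDomain R] {f : Fin k ↪ G.edgeSet}
    (h : ¬ (edgeSubgraph (Finset.univ.map f)).Connected) : (reducedInc R f).det = 0 := by
  obtain ⟨v, hv⟩ : ∃ v, ¬ (edgeSubgraph (Finset.univ.map f)).Reachable 0 v := by
    by_contra! h'
    exact h ((SimpleGraph.connected_iff_exists_forall_reachable _).2 ⟨0, h'⟩)
  let y (w : Fin (k + 1)) : R :=
    if (edgeSubgraph (Finset.univ.map f)).Reachable 0 w then 0 else 1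
  have hy0 : y 0 = 0 := if_pos (SimpleGraph.Reachable.refl _)
  rw [← exists_vecMul_eq_zero_iff]
  refine ⟨fun i => y i.succ, fun h0 => ?_, ?_⟩
  · cases v using Fin.cases with
    | zero => exact hv (SimpleGraph.Reachable.refl _)
    | succ i => simpa [y, hv] using congrFun h0 i
  · ext j
    obtain ⟨a, b, -, he, ho⟩ := exists_out_eq (f j)
    have hadj : (edgeSubgraph (Finset.univ.map f)).Adj a b :=
      edgeSubgraph_adj_of_mem (Finset.mem_map_of_mem f (Finset.mem_univ j)) he
    have hab : y a = y b := by
      have : (edgeSubgraph (Finset.univ.map f)).Reachable 0 a ↔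
          (edgeSubgraph (Finset.univ.map f)).Reachable 0 b :=
        ⟨fun h => h.trans hadj.reachable, fun h => h.trans hadj.symm.reachable⟩
      simp only [y, this]
    have hsum := sum_mul_orientedInc y ho
    rw [Fin.sum_univ_succ, hy0, zero_mul, zero_add, hab, sub_self] at hsum
    exact hsum

open Classical in
theorem det_reducedInc_sq (R : Type*) [CommRing R] (f : Fin k ↪ G.edgeSet) :
    (reducedInc R f).det ^ 2 = if IsSpanningTree G (Finset.univ.map f) then 1 else 0 := by
  have hcard : (Finset.univ.map f).card = k := by simp
  -- Working over `ℤ` makes a unit determinant `±1`, and supplies the domain needed in the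
  -- disconnected case.
  have hmap : (reducedInc R f).det = ((reducedInc ℤ f).det : R) := by
    rw [← eq_intCast (Int.castRingHom R), RingHom.map_det, RingHom.mapMatrix_apply, reducedInc,
      reducedInc, ← orientedInc_map G ℤ R (Int.castRingHom R)]
    rfl
  rw [hmap, isSpanningTree_iff]
  split_ifs with h
  · exact_mod_cast congrArg (Int.cast : ℤ → R) (Int.isUnit_sq (isUnit_det_reducedInc ℤ h.1))
  · rw [det_reducedInc_eq_zero ℤ fun h' => h ⟨h', hcard⟩]
    simp

/-- The weighted matrix-tree theorem: the spanning-tree polynomial is the determinant of the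
weighted Laplacian with the row and the column of one vertex removed. -/
theorem aeval_treePoly [Fintype G.edgeSet] {R : Type*} [CommRing R] (x : G.edgeSet → R) :
    MvPolynomial.aeval x (treePoly G) =
      ((weightedLap x).submatrix Fin.succ Fin.succ).det := by
  classical
  have hL : (weightedLap x).submatrix Fin.succ Fin.succ =
      weightedMul ((orientedInc G R).submatrix Fin.succ id) x
        ((orientedInc G R).submatrix Fin.succ id)ᵀ := rfl
  rw [hL, det_weightedMul_eq_sum_powersetCard, treePoly, map_sum, Fintype.card_fin]
  simp only [map_prod, MvPolynomial.aeval_X]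
  have hsub : ({T | IsSpanningTree G T} : Finset (Finset G.edgeSet)) ⊆
      Finset.powersetCard k Finset.univ := fun T hT =>
    Finset.mem_powersetCard.2
      ⟨Finset.subset_univ _, ((isSpanningTree_iff T).1 (Finset.mem_filter.1 hT).2).2⟩
  have hterm {S : Finset G.edgeSet} (hS : S.card = k) :
      (weightedMul ((orientedInc G R).submatrix Fin.succ id) ((S : Set _).indicator 1)
        ((orientedInc G R).submatrix Fin.succ id)ᵀ).det =
          if IsSpanningTree G S then 1 else 0 := by
    let f : Fin k ↪ G.edgeSet :=
      (S.equivFinOfCardEq hS).symm.toEmbedding.trans (Function.Embedding.subtype _)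
    have hS' : S = Finset.univ.map f := by
      refine (Finset.eq_of_subset_of_card_le (fun e he => ?_) ?_).symm
      · obtain ⟨i, -, rfl⟩ := Finset.mem_map.1 he
        exact ((S.equivFinOfCardEq hS).symm i).2
      · simp [hS]
    rw [hS', det_weightedMul_indicator, ← det_reducedInc_sq R f, sq]
    exact congrArg _ (det_transpose (reducedInc R f))
  rw [← Finset.sum_subset hsub]
  · refine Finset.sum_congr rfl fun T hT => ?_
    rw [hterm (Finset.mem_powersetCard.1 (hsub hT)).2, if_pos (Finset.mem_filter.1 hT).2, mul_one]
  · intro S hS hT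
    rw [hterm (Finset.mem_powersetCard.1 hS).2, if_neg (by simpa using hT), mul_zero]

end MatrixTree

/-! ### Complete graphs -/

section Complete

variable {k : ℕ} {R : Type*} [CommRing R] [Fintype (⊤ : SimpleGraph (Fin (k + 1))).edgeSet]

theorem weightedLap_zero_succ (x : (⊤ : SimpleGraph (Fin (k + 1))).edgeSet → R) (i : Fin k) :
    weightedLap x i.succ 0 = - ∑ j : Fin k, weightedLap x i.succ j.succ := by
  have h := sum_weightedLap x i.succ
  rw [Fin.sum_univ_succ] at h
  exact eq_neg_of_add_eq_zero_left h

/-- Edge weights on a complete graph correspond to symmetric matrices, by means of the reduced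
Laplacian. -/
theorem bijective_reducedLap :
    Function.Bijective fun x : (⊤ : SimpleGraph (Fin (k + 1))).edgeSet → R =>
      (⟨(weightedLap x).submatrix Fin.succ Fin.succ, (weightedLap_isSymm x).submatrix _⟩ :
        {M : Matrix (Fin k) (Fin k) R // M.IsSymm}) := by
  constructor
  · intro x y hxy
    have h (i j : Fin k) : weightedLap x i.succ j.succ = weightedLap y i.succ j.succ :=
      congrFun₂ (congrArg Subtype.val hxy) i j
    have h0 (i : Fin k) : weightedLap x i.succ 0 = weightedLap y i.succ 0 := by
      simp only [weightedLap_zero_succ, h]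
    ext ⟨e, he⟩
    induction e with
    | h v w =>
      rw [← neg_inj, ← weightedLap_apply_of_adj x he, ← weightedLap_apply_of_adj y he]
      cases v using Fin.cases with
      | zero =>
        cases w using Fin.cases with
        | zero => exact (he rfl).elim
        | succ j => rw [← (weightedLap_isSymm x).apply, ← (weightedLap_isSymm y).apply, h0]
      | succ i =>
        cases w using Fin.cases with
        | zero => exact h0 i
        | succ j => exact h i j
  · rintro ⟨M, hM⟩
    -- The border makes the off-corner row sums vanish. The corner `0` is arbitrary: the weights
    -- read only off-diagonal entries.
    let N := bordered 0 (fun i => - ∑ j, M i j) M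
    have hN : N.IsSymm := (isSymm_bordered_iff _ _ _).2 hM
    let x (e : (⊤ : SimpleGraph (Fin (k + 1))).edgeSet) : R :=
      Sym2.lift ⟨fun v w => - N v w, fun v w => congrArg Neg.neg (hN.apply v w).symm⟩ e.1
    have hx {v w : Fin (k + 1)} (h : v ≠ w) : weightedLap x v w = N v w :=
      (weightedLap_apply_of_adj x h).trans (neg_neg _)
    refine ⟨x, Subtype.ext ?_⟩
    ext i j
    -- Diagonal entries are no edge weights; they are recovered from the vanishing row sums.
    by_cases hij : i = j
    · subst hij
      have h0 := weightedLap_zero_succ x i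
      rw [hx (Fin.succ_ne_zero i)] at h0
      have hrow (j : Fin k) (hj : j ∈ ({i}ᶜ : Finset (Fin k))) :
          weightedLap x i.succ j.succ = M i j :=
        hx (by simpa [eq_comm] using hj)
      have h1 : ∑ j, M i j = ∑ j : Fin k, weightedLap x i.succ j.succ := neg_injective h0
      rw [Fintype.sum_eq_add_sum_compl i, Fintype.sum_eq_add_sum_compl i,
        Finset.sum_congr rfl hrow] at h1
      exact (add_right_cancel h1).symm
    · exact hx (by simpa using hij)

theorem g_top_eq_symmCount (F : Type*) [Field F] :
    g (⊤ : SimpleGraph (Fin (k + 1))) F = symmCount F k := by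
  rw [g, symmCount_eq, ← Nat.card_congr
    (Equiv.subtypeSubtypeEquivSubtypeInter (fun M : Matrix (Fin k) (Fin k) F => M.IsSymm)
      fun M => M.det ≠ 0)]
  refine Nat.card_congr ((Equiv.ofBijective _ bijective_reducedLap).subtypeEquiv fun x => ?_)
  rw [aeval_treePoly]
  rfl

end Complete

end SpanningTreeCount

theorem mainTheorem1 (n : ℕ) (hn : 1 ≤ n) (F : Type*) [Field F] [Finite F]
    (q : ℕ) (hq : Nat.card F = q) :
    SpanningTreeCount.g (⊤ : SimpleGraph (Fin n)) F =
        Nat.card {M : Matrix (Fin (n - 1)) (Fin (n - 1)) F // M.IsSymm ∧ IsUnit M} ∧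
    (∀ m : ℕ, n = 2 * m →
      (SpanningTreeCount.g (⊤ : SimpleGraph (Fin n)) F : ℤ) =
        (q : ℤ) ^ (m * (m - 1)) * ∏ i ∈ Finset.Icc 1 m, ((q : ℤ) ^ (2 * i - 1) - 1)) ∧
    (∀ m : ℕ, n = 2 * m + 1 →
      (SpanningTreeCount.g (⊤ : SimpleGraph (Fin n)) F : ℤ) =
        (q : ℤ) ^ (m * (m + 1)) * ∏ i ∈ Finset.Icc 1 m, ((q : ℤ) ^ (2 * i - 1) - 1)) := by
  have := Fintype.ofFinite F
  obtain ⟨k, rfl⟩ : ∃ k, n = k + 1 := ⟨n - 1, by omega⟩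
  rw [Nat.card_eq_fintype_card] at hq
  subst hq
  rw [SpanningTreeCount.g_top_eq_symmCount]
  refine ⟨rfl, fun m hm => ?_, fun m hm => ?_⟩
  · obtain ⟨l, rfl⟩ : ∃ l, m = l + 1 := ⟨m - 1, by omega⟩
    obtain rfl : k = 2 * l + 1 := by omega
    rw [(SpanningTreeCount.symmCount_two_mul_and l).2, Nat.add_sub_cancel, mul_comm l]
  · obtain rfl : k = 2 * m := by omega
    exact (SpanningTreeCount.symmCount_two_mul_and m).1
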